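/- All compact spaces are Hausdorff. A \emph{uniform algebra} on a compact space $X$ is a closed subalgebra of $C(X)$ (complex-valued functions, supremum norm) that contains the constants and separates the points of $X$; the \emph{hull} of an ideal is its common zero set in $X$, and $A|S$ denotes the algebra of restrictions to $S$ of the functions in $A$, with the supremum norm on $S$. Given a uniform algebra $A$ on $X$ and $\mathscr F\subset A$, let $X_{\mathscr F}=\{(x,(z_f)_{f\in\mathscr F})\in X\times\mathbb C^{\mathscr F}: z_f^2=f(x)\ \text{for all } f\in\mathscr F\}$, let $\pi:X_{\mathscr F}\to X$ (the associated surjection) and $p_f:X_{\mathscr F}\to\mathbb C$ be the coordinate projections, and let the \emph{$\mathscr F$-extension} $A_{\mathscr F}$ be the closed subalgebra of $C(X_{\mathscr F})$ generated by $\{f\circ\pi: f\in A\}\cup\{p_f: f\in\mathscr F\}$. Let $T:A_{\mathscr F}\to A$ be the operator given by integration over the fibers of $\pi$ with respect to the probability measure on each fiber that is invariant under the action of $\{1,-1\}^{\mathscr F}$ by sign changes of the coordinates $z_f$. Let $\tau$ be an infinite ordinal. A \emph{system of root extensions} consists of compact spaces $X_\alpha$, uniform algebras $A_\alpha$ on $X_\alpha$,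 and continuous surjections $\pi_{\alpha,\beta}:X_\beta\to X_\alpha$ $(0\le\alpha\le\beta\le\tau)$ such that: (1) $\pi_{\alpha,\beta}^*(f)=f\circ\pi_{\alpha,\beta}$ maps $A_\alpha$ into $A_\beta$; (2) $\pi_{\alpha,\beta}\circ\pi_{\beta,\gamma}=\pi_{\alpha,\gamma}$ for $\alpha\le\beta\le\gamma$, and $\pi_{\alpha,\alpha}$ is the identity; (3) for each $\alpha<\tau$ there is a specified subset $\mathscr F_\alpha\subset A_\alpha$ such that $A_{\alpha+1}$ on $X_{\alpha+1}$ is the $\mathscr F_\alpha$-extension of $A_\alpha$ and $\pi_{\alpha,\alpha+1}$ is the associated surjection; (4) for each limit ordinal $\gamma\le\tau$, $X_\gamma$ with the maps $\pi_{\alpha,\gamma}$ is the inverse limit of $\{X_\alpha,\pi_{\alpha,\beta}\}_{\alpha\le\beta<\gamma}$, and $A_\gamma$ is the closure in $C(X_\gamma)$ of $\bigcup_{\alpha<\gamma}\pi^*_{\alpha,\gamma}(A_\alpha)$. Continuous linear operators $T_{0,\alpha}:A_\alpha\to A_0$ are defined by transfinite recursion: $T_{0,0}$ is the identity; $T_{0,\alpha+1}=T_{0,\alpha}\circ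 T$ with $T:A_{\alpha+1}\to A_\alpha$ as above; and for a limit ordinal $\gamma$, $T_{0,\gamma}$ is the unique continuous linear operator with $T_{0,\gamma}\circ\pi^*_{\alpha,\gamma}=T_{0,\alpha}$ for all $\alpha<\gamma$. \textbf{Theorem.} Let $(\{A_\alpha\},\{X_\alpha\},\{\pi_{\alpha,\beta}\})$ be a system of root extensions, let $I_0$ be a closed ideal in $A_0$, and put $S_0=\operatorname{hull}(I_0)$. For $0\le\alpha\le\tau$ set $I_\alpha=T_{0,\alpha}^{-1}(I_0)$ and $S_\alpha=\pi_{0,\alpha}^{-1}(S_0)$. Suppose that $\mathscr F_\alpha\subset I_\alpha$ for every $0\le\alpha<\tau$. Then for every $0\le\alpha\le\tau$: \begin{enumerate} \item[(i)] $\pi_{0,\alpha}$ takes $S_\alpha$ homeomorphically onto $S_0$. \item[(ii)] $f|S_0\mapsto\pi_{0,\alpha}^*(f)|S_\alpha$ $(f\in A_0)$ is a well-defined isometric algebra isomorphism of $A_0|S_0$ onto $A_\alpha|S_\alpha$. \item[(iii)] $I_\alpha$ is a closed ideal in $A_\alpha$ with $\operatorname{hull}(I_\alpha)=S_\alpha$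 and $I_\alpha\cap\pi_{0,\alpha}^*(A_0)=\pi_{0,\alpha}^*(I_0)$, and $A_\alpha/I_\alpha$ is isometrically isomorphic as a Banach algebra to $A_0/I_0$. Consequently, there is an order-preserving (in both directions) bijective correspondence between the closed ideals of $A_\alpha$ containing $I_\alpha$ and the closed ideals of $A_0$ containing $I_0$. \end{enumerate} -/

import Mathlib

open MeasureTheory Topology

universe u v

noncomputable section

/-! ### Uniform algebras, hulls, restrictions -/

/-- A uniform algebra on `X`: a closed subalgebra of `C(X, ℂ)` (sup norm) that contains the
constants (automatic for a `Subalgebra ℂ`) and separates the points of `X`. -/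
structure IsUniformAlgebra {X : Type*} [TopologicalSpace X] [CompactSpace X]
    (A : Subalgebra ℂ C(X, ℂ)) : Prop where
  isClosed : IsClosed (A : Set C(X, ℂ))
  separatesPoints : A.SeparatesPoints

/-- The hull of an ideal `I` of `A`: the common zero set in `X` of the functions in `I`. -/
def hull {X : Type*} [TopologicalSpace X] {A : Subalgebra ℂ C(X, ℂ)} (I : Ideal A) : Set X :=
  {x | ∀ f ∈ I, (f : C(X, ℂ)) x = 0}

theorem isClosed_hull {X : Type*} [TopologicalSpace X] {A : Subalgebra ℂ C(X, ℂ)} (I : Ideal A) :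
    IsClosed (hull I) := by
  have : hull I = ⋂ f ∈ I, (f : C(X, ℂ)) ⁻¹' {0} := by
    ext x; simp [hull]
  rw [this]
  exact isClosed_biInter fun f _ => isClosed_singleton.preimage (f : C(X, ℂ)).continuous

/-- Restriction of continuous functions to a subset `S`. -/
def restrictHom {X : Type*} [TopologicalSpace X] (S : Set X) : C(X, ℂ) →ₐ[ℂ] C(S, ℂ) :=
  ContinuousMap.compRightAlgHom ℂ ℂ ⟨Subtype.val, continuous_subtype_val⟩

/-- `A | S`, the algebra of restrictions to `S` of the functions in `A`, with the sup norm
on `S` when `S` is compact. -/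
def restrictAlgebra {X : Type*} [TopologicalSpace X] (A : Subalgebra ℂ C(X, ℂ)) (S : Set X) :
    Subalgebra ℂ C(S, ℂ) :=
  A.map (restrictHom S)

/-- The restriction `f | S` of `f ∈ A`, as an element of `A | S`. -/
def restrictElem {X : Type*} [TopologicalSpace X] {A : Subalgebra ℂ C(X, ℂ)} (S : Set X) (f : A) :
    restrictAlgebra A S :=
  ⟨restrictHom S f, f, f.2, rfl⟩

/-! ### One root extension -/

section RootExtension

variable {X : Type*} [TopologicalSpace X] {A : Subalgebra ℂ C(X, ℂ)}

/-- The space `X_F` of all `(x, z) ∈ X × ℂ^F` with `z_f ^ 2 = f x` for all `f ∈ F`. -/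
def RootSpace (F : Set A) : Type _ :=
  {y : X × (F → ℂ) // ∀ f : F, y.2 f ^ 2 = (f.1 : C(X, ℂ)) y.1}

instance (F : Set A) : TopologicalSpace (RootSpace F) :=
  inferInstanceAs (TopologicalSpace {y : X × (F → ℂ) // ∀ f : F, y.2 f ^ 2 = (f.1 : C(X, ℂ)) y.1})

/-- The projection `π : X_F → X`. -/
def RootSpace.proj (F : Set A) : C(RootSpace F, X) :=
  ⟨fun y => y.1.1, continuous_fst.comp continuous_subtype_val⟩

/-- The adjoined square root `p_f : X_F → ℂ` of `f ∘ π`. -/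
def RootSpace.root {F : Set A} (f : F) : C(RootSpace F, ℂ) :=
  ⟨fun y => y.1.2 f, (continuous_apply f).comp (continuous_snd.comp continuous_subtype_val)⟩

/-- The `F`-extension `A_F`: the closed subalgebra of `C(X_F, ℂ)` generated by the functions
`f ∘ π`, `f ∈ A`, and `p_f`, `f ∈ F`. -/
def rootAlgebra (F : Set A) [CompactSpace (RootSpace F)] : Subalgebra ℂ C(RootSpace F, ℂ) :=
  (Algebra.adjoin ℂ
    ({g | ∃ f ∈ A, g = f.comp (RootSpace.proj F)} ∪
      Set.range (RootSpace.root (F := F)))).topologicalClosure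

theorem RootSpace.compactSpace_aux [CompactSpace X] (F : Set A) :
    CompactSpace (RootSpace F) := by
  have hc : IsCompact {y : X × (F → ℂ) | ∀ f : F, y.2 f ^ 2 = (f.1 : C(X, ℂ)) y.1} := by
    have hK : IsCompact ((Set.univ : Set X) ×ˢ Set.pi Set.univ
        (fun f : F => Metric.closedBall (0 : ℂ) (‖(f.1 : C(X, ℂ))‖ + 1))) :=
      isCompact_univ.prod (isCompact_univ_pi fun f => isCompact_closedBall _ _)
    refine hK.of_isClosed_subset ?_ ?_
    · simp only [Set.ofPred_forall]
      refine isClosed_iInter fun f => isClosed_eq ?_ ?_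
      · fun_prop
      · exact (f.1 : C(X, ℂ)).continuous.comp continuous_fst
    · rintro ⟨x, z⟩ h
      simp only [Set.mem_prod, Set.mem_univ, Set.mem_pi, true_and, forall_const]
      intro f
      have h1 : ‖z f‖ ^ 2 ≤ ‖(f.1 : C(X, ℂ))‖ := by
        rw [← norm_pow, h f]
        exact ContinuousMap.norm_coe_le_norm _ _
      rw [mem_closedBall_zero_iff]
      nlinarith [norm_nonneg (z f), sq_nonneg (‖z f‖ - 1)]
  exact isCompact_iff_compactSpace.mp hc

instance [CompactSpace X] (F : Set A) : CompactSpace (RootSpace F) :=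
  RootSpace.compactSpace_aux F

/-- The compact group `{1, -1}^F` (that is, `(ℤ/2)^F`), with its Borel σ-algebra. -/
def SignGroup (F : Set A) : Type _ := F → ℤˣ

instance (F : Set A) : CommGroup (SignGroup F) := inferInstanceAs (CommGroup (F → ℤˣ))
instance (F : Set A) : TopologicalSpace (SignGroup F) := inferInstanceAs (TopologicalSpace (F → ℤˣ))
instance (F : Set A) : IsTopologicalGroup (SignGroup F) :=
  inferInstanceAs (IsTopologicalGroup (F → ℤˣ))
instance (F : Set A) : CompactSpace (SignGroup F) := inferInstanceAs (CompactSpace (F → ℤˣ))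
instance (F : Set A) : T2Space (SignGroup F) := inferInstanceAs (T2Space (F → ℤˣ))
instance (F : Set A) : MeasurableSpace (SignGroup F) := borel _
instance (F : Set A) : BorelSpace (SignGroup F) := ⟨rfl⟩

/-- Normalized Haar measure on `{1, -1}^F`. -/
def signHaar (F : Set A) : Measure (SignGroup F) := Measure.haarMeasure ⊤

instance (F : Set A) : IsProbabilityMeasure (signHaar F) :=
  ⟨by simpa [signHaar] using Measure.haarMeasure_self (G := SignGroup F) (K₀ := ⊤)⟩

/-- The action of `{1, -1}^F` on `X_F`, changing the signs of the square roots. -/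
def RootSpace.act {F : Set A} (s : SignGroup F) (y : RootSpace F) : RootSpace F :=
  ⟨(y.1.1, fun f => ((s f : ℤ) : ℂ) * y.1.2 f), fun f => by
    have h : (((s f : ℤ) : ℂ)) ^ 2 = 1 := by
      rcases Int.units_eq_one_or (s f) with h | h <;> simp [h]
    simp only [mul_pow, h, one_mul]
    exact y.2 f⟩

theorem RootSpace.continuous_act {F : Set A} (y : RootSpace F) :
    Continuous fun s : SignGroup F => RootSpace.act s y := by
  refine Continuous.subtype_mk (continuous_const.prodMk (continuous_pi fun f => ?_)) _
  refine Continuous.mul ?_ continuous_const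
  have h1 : Continuous fun u : ℤˣ => ((u : ℤ) : ℂ) := continuous_of_discreteTopology
  exact h1.comp (continuous_apply f)

/-- A point of the fiber of `π` over `x`. -/
def RootSpace.base (F : Set A) (x : X) : RootSpace F :=
  ⟨(x, fun f => ((f.1 : C(X, ℂ)) x) ^ ((2 : ℕ)⁻¹ : ℂ)), fun _ =>
    Complex.cpow_nat_inv_pow _ two_ne_zero⟩

/-- The integral of `g` over the fiber of `π` above `x` with respect to the probability measure on
the fiber that is invariant under `{1, -1}^F`. The fiber is a single orbit, so this measure is the
image of Haar measure under an orbit map, for any base point (see `fiberAverage_proj`). -/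
def fiberAverage {F : Set A} (g : C(RootSpace F, ℂ)) (x : X) : ℂ :=
  ∫ s, g (RootSpace.act s (RootSpace.base F x)) ∂(signHaar F)

/-- The group acts transitively on the fibers of `π`. -/
theorem RootSpace.exists_act_eq {F : Set A} {y y' : RootSpace F} (h : y.1.1 = y'.1.1) :
    ∃ s : SignGroup F, RootSpace.act s y = y' := by
  have hf : ∀ f : F, ∃ u : ℤˣ, ((u : ℤ) : ℂ) * y.1.2 f = y'.1.2 f := by
    intro f
    have h2 : y.1.2 f ^ 2 = y'.1.2 f ^ 2 := by rw [y.2 f, y'.2 f, h]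
    rcases sq_eq_sq_iff_eq_or_eq_neg.mp h2 with h3 | h3
    · exact ⟨1, by simp [h3]⟩
    · exact ⟨-1, by simp [h3]⟩
  choose s hs using hf
  exact ⟨s, Subtype.ext (Prod.ext h (funext hs))⟩

theorem RootSpace.act_mul {F : Set A} (s t : SignGroup F) (y : RootSpace F) :
    RootSpace.act (s * t) y = RootSpace.act s (RootSpace.act t y) := by
  refine Subtype.ext (Prod.ext rfl (funext fun f => ?_))
  change (((s f * t f : ℤˣ) : ℤ) : ℂ) * y.1.2 f = ((s f : ℤ) : ℂ) * (((t f : ℤ) : ℂ) * y.1.2 f)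
  push_cast
  ring

/-- The fiber average may be computed from any point of the fiber. -/
theorem fiberAverage_proj {F : Set A} (g : C(RootSpace F, ℂ)) (y : RootSpace F) :
    fiberAverage g (RootSpace.proj F y) = ∫ s, g (RootSpace.act s y) ∂(signHaar F) := by
  obtain ⟨t, ht⟩ := RootSpace.exists_act_eq (y := y)
    (y' := RootSpace.base F (RootSpace.proj F y)) rfl
  have : (signHaar F).IsMulLeftInvariant := by unfold signHaar; infer_instance
  have := integral_mul_left_eq_self (μ := signHaar F) (fun s => g (RootSpace.act s y)) t
  rw [fiberAverage, ← ht, ← this]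
  simp_rw [mul_comm t, RootSpace.act_mul]

theorem integrable_orbit {F : Set A} (g : C(RootSpace F, ℂ)) (y : RootSpace F) :
    Integrable (fun s => g (RootSpace.act s y)) (signHaar F) :=
  (g.continuous.comp (RootSpace.continuous_act y)).integrable_of_hasCompactSupport
    (HasCompactSupport.of_compactSpace _)

theorem fiberAverage_add {F : Set A} (g h : C(RootSpace F, ℂ)) (x : X) :
    fiberAverage (g + h) x = fiberAverage g x + fiberAverage h x :=
  integral_add (integrable_orbit g _) (integrable_orbit h _)

theorem fiberAverage_smul {F : Set A} (c : ℂ) (g : C(RootSpace F, ℂ)) (x : X) :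
    fiberAverage (c • g) x = c * fiberAverage g x :=
  integral_smul c _

theorem norm_fiberAverage_le {F : Set A} [CompactSpace X] (g : C(RootSpace F, ℂ)) (x : X) :
    ‖fiberAverage g x‖ ≤ ‖g‖ := by
  have := norm_integral_le_of_norm_le_const (μ := signHaar F)
    (f := fun s => g (RootSpace.act s (RootSpace.base F x))) (C := ‖g‖)
    (Filter.Eventually.of_forall fun s => ContinuousMap.norm_coe_le_norm _ _)
  simpa [fiberAverage] using this

theorem fiberAverage_comp_proj {F : Set A} (f : C(X, ℂ)) (x : X) :
    fiberAverage (f.comp (RootSpace.proj F)) x = f x := by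
  have : ∀ s, (f.comp (RootSpace.proj F)) (RootSpace.act s (RootSpace.base F x)) = f x :=
    fun _ => rfl
  simp [fiberAverage, this]

open Classical in
theorem fiberAverage_monomial {F : Set A} (f : C(X, ℂ)) (t : Finset F) (ht : t.Nonempty) (x : X) :
    fiberAverage (f.comp (RootSpace.proj F) * ∏ i ∈ t, RootSpace.root i) x = 0 := by
  obtain ⟨i, hi⟩ := ht
  have : (signHaar F).IsMulLeftInvariant := by unfold signHaar; infer_instance
  set g := f.comp (RootSpace.proj F) * ∏ i ∈ t, RootSpace.root i with hg
  let u : SignGroup F := Function.update (1 : F → ℤˣ) i (-1)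
  have h1 := integral_mul_left_eq_self (μ := signHaar F)
    (fun s => g (RootSpace.act s (RootSpace.base F x))) u
  have h2 : ∀ y, g (RootSpace.act u y) = - g y := by
    intro y
    simp only [hg, ContinuousMap.mul_apply, ContinuousMap.prod_apply, ContinuousMap.comp_apply]
    have h3 : ∀ j : F, RootSpace.root j (RootSpace.act u y)
        = (if j = i then -1 else 1) * RootSpace.root j y := by
      intro j
      change (((u j : ℤˣ) : ℤ) : ℂ) * y.1.2 j = _ * y.1.2 j
      by_cases hj : j = i <;> simp [u, hj]
    simp only [h3, Finset.prod_mul_distrib]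
    have h4 : RootSpace.proj F (RootSpace.act u y) = RootSpace.proj F y := rfl
    rw [h4, Finset.prod_ite_eq' t i, if_pos hi]
    ring
  simp only [RootSpace.act_mul, h2, integral_neg] at h1
  have h5 : ∀ z : ℂ, -z = z → z = 0 := fun z hz => by
    have : (2 : ℂ) * z = 0 := by linear_combination -hz
    simpa using this
  exact h5 _ h1

/-- The linear span of the functions `(f ∘ π) p_{f_1} ⋯ p_{f_r}`. -/
def rootSpan (F : Set A) : Submodule ℂ C(RootSpace F, ℂ) :=
  Submodule.span ℂ {g | ∃ f ∈ A, ∃ t : Finset F,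
    g = f.comp (RootSpace.proj F) * ∏ i ∈ t, RootSpace.root i}

open Classical in
theorem rootSpan_mul {F : Set A} {g h : C(RootSpace F, ℂ)} (hg : g ∈ rootSpan F)
    (hh : h ∈ rootSpan F) : g * h ∈ rootSpan F := by
  have hsq : ∀ t : Finset F, ∃ f ∈ A, ∏ i ∈ t, (RootSpace.root i * RootSpace.root i)
      = f.comp (RootSpace.proj F) := by
    intro t
    refine ⟨∏ i ∈ t, (i.1 : C(X, ℂ)), A.prod_mem fun i _ => i.1.2, ?_⟩
    ext y
    simp only [ContinuousMap.prod_apply, ContinuousMap.comp_apply, ContinuousMap.mul_apply]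
    refine Finset.prod_congr rfl fun i _ => ?_
    rw [← sq]
    exact y.2 i
  have hmul := Submodule.mul_mem_mul hg hh
  rw [rootSpan, Submodule.span_mul_span] at hmul
  refine Submodule.span_mono ?_ hmul
  rintro _ ⟨_, ⟨f, hf, s, rfl⟩, _, ⟨f', hf', t, rfl⟩, rfl⟩
  obtain ⟨k, hk, hk'⟩ := hsq (s ∩ t)
  refine ⟨f * f' * k, A.mul_mem (A.mul_mem hf hf') hk, symmDiff s t, ?_⟩
  have h1 : (∏ i ∈ s, RootSpace.root i) * (∏ i ∈ t, RootSpace.root i)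
      = k.comp (RootSpace.proj F) * ∏ i ∈ symmDiff s t, RootSpace.root i := by
    rw [← hk', Finset.prod_mul_distrib]
    have hs : ∏ i ∈ s, RootSpace.root i
        = (∏ i ∈ s ∩ t, RootSpace.root i) * ∏ i ∈ s \ t, RootSpace.root i := by
      rw [Finset.prod_inter_mul_prod_sdiff]
    have ht : ∏ i ∈ t, RootSpace.root i
        = (∏ i ∈ s ∩ t, RootSpace.root i) * ∏ i ∈ t \ s, RootSpace.root i := by
      rw [Finset.inter_comm, Finset.prod_inter_mul_prod_sdiff]
    have hd : ∏ i ∈ symmDiff s t, RootSpace.root i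
        = (∏ i ∈ s \ t, RootSpace.root i) * ∏ i ∈ t \ s, RootSpace.root i := by
      rw [symmDiff_def, Finset.sup_eq_union, Finset.prod_union disjoint_sdiff_sdiff]
    rw [hs, ht, hd]
    ring
  have h2 : (f * f' * k).comp (RootSpace.proj F) = f.comp (RootSpace.proj F)
      * f'.comp (RootSpace.proj F) * k.comp (RootSpace.proj F) := rfl
  change (f.comp (RootSpace.proj F) * ∏ i ∈ s, RootSpace.root i) *
    (f'.comp (RootSpace.proj F) * ∏ i ∈ t, RootSpace.root i) = _
  rw [h2]
  linear_combination (f.comp (RootSpace.proj F) * f'.comp (RootSpace.proj F)) * h1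

theorem adjoin_subset_rootSpan {F : Set A} {g : C(RootSpace F, ℂ)}
    (hg : g ∈ Algebra.adjoin ℂ ({g | ∃ f ∈ A, g = f.comp (RootSpace.proj F)} ∪
      Set.range (RootSpace.root (F := F)))) : g ∈ rootSpan F := by
  induction hg using Algebra.adjoin_induction with
  | mem g hg =>
    refine Submodule.subset_span ?_
    rcases hg with ⟨f, hf, rfl⟩ | ⟨f, rfl⟩
    · exact ⟨f, hf, ∅, by simp⟩
    · exact ⟨1, A.one_mem, {f}, by ext; simp⟩
  | algebraMap c =>
    exact Submodule.subset_span ⟨algebraMap ℂ _ c, A.algebraMap_mem c, ∅, by ext; simp⟩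
  | add g h _ _ hg hh => exact (rootSpan F).add_mem hg hh
  | mul g h _ _ hg hh => exact rootSpan_mul hg hh

theorem fiberAverage_rootSpan {F : Set A} {g : C(RootSpace F, ℂ)} (hg : g ∈ rootSpan F) :
    ∃ f ∈ A, ∀ x, f x = fiberAverage g x := by
  induction hg using Submodule.span_induction with
  | mem g hg =>
    obtain ⟨f, hf, t, rfl⟩ := hg
    rcases t.eq_empty_or_nonempty with rfl | ht
    · exact ⟨f, hf, fun x => by simp [fiberAverage_comp_proj]⟩
    · exact ⟨0, A.zero_mem, fun x => by simp [fiberAverage_monomial f t ht x]⟩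
  | zero => exact ⟨0, A.zero_mem, fun x => by simp [fiberAverage]⟩
  | add g h _ _ hg hh =>
    obtain ⟨f, hf, h1⟩ := hg
    obtain ⟨f', hf', h2⟩ := hh
    exact ⟨f + f', A.add_mem hf hf', fun x => by simp [fiberAverage_add, h1, h2]⟩
  | smul c g _ hg =>
    obtain ⟨f, hf, h1⟩ := hg
    exact ⟨c • f, A.smul_mem hf c, fun x => by simp [fiberAverage_smul, h1]⟩

/-- Averaging over the fibers maps `A_F` into `A`. -/
theorem fiberAverage_mem [CompactSpace X] (hA : IsClosed (A : Set C(X, ℂ))) {F : Set A}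
    {g : C(RootSpace F, ℂ)} (hg : g ∈ rootAlgebra F) :
    ∃ f ∈ A, ∀ x, f x = fiberAverage g x := by
  have hg' : g ∈ closure (Algebra.adjoin ℂ ({g | ∃ f ∈ A, g = f.comp (RootSpace.proj F)} ∪
      Set.range (RootSpace.root (F := F))) : Set C(RootSpace F, ℂ)) := hg
  obtain ⟨u, hu, hlim⟩ := mem_closure_iff_seq_limit.mp hg'
  choose f hfA hf using fun n => fiberAverage_rootSpan (adjoin_subset_rootSpan (hu n))
  have hsub : ∀ (g h : C(RootSpace F, ℂ)) x,
      fiberAverage (g - h) x = fiberAverage g x - fiberAverage h x := by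
    intro g h x
    rw [eq_sub_iff_add_eq, ← fiberAverage_add, sub_add_cancel]
  have hle : ∀ n m, dist (f n) (f m) ≤ dist (u n) (u m) := by
    intro n m
    rw [dist_eq_norm, dist_eq_norm, ContinuousMap.norm_le _ (norm_nonneg _)]
    intro x
    rw [ContinuousMap.sub_apply, hf, hf, ← hsub]
    exact norm_fiberAverage_le _ _
  have hcau : CauchySeq f := by
    rw [Metric.cauchySeq_iff]
    intro ε hε
    obtain ⟨N, hN⟩ := Metric.cauchySeq_iff.mp hlim.cauchySeq ε hε
    exact ⟨N, fun m hm n hn => (hle m n).trans_lt (hN m hm n hn)⟩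
  obtain ⟨k, hk⟩ := cauchySeq_tendsto_of_complete hcau
  refine ⟨k, hA.mem_of_tendsto hk (Filter.Eventually.of_forall hfA), fun x => ?_⟩
  have h1 : Filter.Tendsto (fun n => f n x) Filter.atTop (𝓝 (k x)) :=
    ((continuous_eval_const x).tendsto k).comp hk
  have h2 : Filter.Tendsto (fun n => fiberAverage (u n) x) Filter.atTop
      (𝓝 (fiberAverage g x)) := by
    rw [tendsto_iff_norm_sub_tendsto_zero]
    refine squeeze_zero (fun _ => norm_nonneg _) (fun n => ?_)
      (tendsto_iff_norm_sub_tendsto_zero.mp hlim)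
    rw [← hsub]
    exact norm_fiberAverage_le _ _
  simp only [hf] at h1
  exact tendsto_nhds_unique h1 h2

/-- The operator `T : A_F → A` given by averaging over the fibers of `π`. -/
def rootAverage [CompactSpace X] (hA : IsClosed (A : Set C(X, ℂ))) (F : Set A) :
    rootAlgebra F →L[ℂ] A :=
  LinearMap.mkContinuous
    { toFun := fun g => ⟨(fiberAverage_mem hA g.2).choose, (fiberAverage_mem hA g.2).choose_spec.1⟩
      map_add' := fun g h => by
        refine Subtype.ext (ContinuousMap.ext fun x => ?_)
        simp only [Subalgebra.coe_add, ContinuousMap.add_apply]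
        rw [(fiberAverage_mem hA (g + h).2).choose_spec.2,
          (fiberAverage_mem hA g.2).choose_spec.2, (fiberAverage_mem hA h.2).choose_spec.2]
        exact fiberAverage_add _ _ _
      map_smul' := fun c g => by
        refine Subtype.ext (ContinuousMap.ext fun x => ?_)
        simp only [Subalgebra.coe_smul, ContinuousMap.smul_apply, RingHom.id_apply, smul_eq_mul]
        rw [(fiberAverage_mem hA (c • g).2).choose_spec.2,
          (fiberAverage_mem hA g.2).choose_spec.2]
        exact fiberAverage_smul _ _ _ } 1
    (fun g => by
      rw [one_mul]
      refine (ContinuousMap.norm_le _ (norm_nonneg _)).mpr fun x => ?_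
      change ‖(fiberAverage_mem hA g.2).choose x‖ ≤ _
      rw [(fiberAverage_mem hA g.2).choose_spec.2]
      exact norm_fiberAverage_le _ _)

theorem rootAverage_apply [CompactSpace X] (hA : IsClosed (A : Set C(X, ℂ))) (F : Set A)
    (g : rootAlgebra F) (x : X) :
    (rootAverage hA F g : C(X, ℂ)) x = fiberAverage (g : C(RootSpace F, ℂ)) x :=
  (fiberAverage_mem hA g.2).choose_spec.2 x

theorem norm_rootAverage_le [CompactSpace X] (hA : IsClosed (A : Set C(X, ℂ))) (F : Set A)
    (g : rootAlgebra F) : ‖rootAverage hA F g‖ ≤ ‖g‖ := by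
  refine (ContinuousMap.norm_le _ (norm_nonneg _)).mpr fun x => ?_
  change ‖(rootAverage hA F g : C(X, ℂ)) x‖ ≤ _
  rw [rootAverage_apply]
  exact norm_fiberAverage_le _ _

end RootExtension

/-- A compatible family of contractions on a directed family of normed spaces with dense union
extends to the whole space. -/
theorem exists_contraction_extension {ι : Type*} [LinearOrder ι] [Nonempty ι] {E G : Type*}
    [NormedAddCommGroup E] [NormedSpace ℂ E] [NormedAddCommGroup G] [NormedSpace ℂ G]
    [CompleteSpace G] {B : ι → Type*} [∀ i, NormedAddCommGroup (B i)] [∀ i, NormedSpace ℂ (B i)]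
    (P : ∀ i, B i →ₗ[ℂ] E) (Q : ∀ i j, i ≤ j → B i →ₗ[ℂ] B j) (R : ∀ i, B i →ₗ[ℂ] G)
    (hP : ∀ i f, ‖P i f‖ = ‖f‖) (hPQ : ∀ i j h f, P j (Q i j h f) = P i f)
    (hRQ : ∀ i j h f, R j (Q i j h f) = R i f) (hR : ∀ i f, ‖R i f‖ ≤ ‖f‖)
    (hd : Dense {g | ∃ i f, P i f = g}) :
    ∃ L : E →L[ℂ] G, (∀ i f, L (P i f) = R i f) ∧ ∀ g, ‖L g‖ ≤ ‖g‖ := by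
  let D : Submodule ℂ E :=
    { carrier := {g | ∃ i f, P i f = g}
      add_mem' := by
        rintro _ _ ⟨i, f, rfl⟩ ⟨j, k, rfl⟩
        refine ⟨max i j, Q i _ (le_max_left _ _) f + Q j _ (le_max_right _ _) k, ?_⟩
        rw [map_add, hPQ, hPQ]
      zero_mem' := ⟨Classical.arbitrary ι, 0, map_zero _⟩
      smul_mem' := by
        rintro c _ ⟨i, f, rfl⟩
        exact ⟨i, c • f, map_smul _ _ _⟩ }
  have hDr : DenseRange D.subtype := by
    have : Set.range D.subtype = {g | ∃ i f, P i f = g} := by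
      ext g
      simp [D]
    rw [DenseRange, this]
    exact hd
  have hwd : ∀ i j f k, P i f = P j k → R i f = R j k := by
    intro i j f k hfk
    rw [← hRQ i (max i j) (le_max_left _ _) f, ← hRQ j (max i j) (le_max_right _ _) k]
    congr 1
    rw [← sub_eq_zero, ← norm_eq_zero, ← hP, map_sub, hPQ, hPQ, hfk, sub_self, norm_zero]
  choose b f hf using fun g : D => g.2
  have key : ∀ (g : D) i k, P i k = g → R (b g) (f g) = R i k :=
    fun g i k hk => hwd _ _ _ _ ((hf g).trans hk.symm)
  let L₀ : D →ₗ[ℂ] G :=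
    { toFun := fun g => R (b g) (f g)
      map_add' := fun g g' => by
        rw [key g _ (Q _ _ (le_max_left (b g) (b g')) (f g)) (by rw [hPQ, hf]),
          key g' _ (Q _ _ (le_max_right (b g) (b g')) (f g')) (by rw [hPQ, hf]), ← map_add]
        exact key _ _ _ (by rw [map_add, hPQ, hPQ, hf, hf]; rfl)
      map_smul' := fun c g => by
        rw [RingHom.id_apply, ← map_smul]
        exact key _ _ _ (by rw [map_smul, hf]; rfl) }
  have hb₀ : ∀ g, ‖L₀ g‖ ≤ 1 * ‖D.subtype g‖ := by
    intro g
    rw [one_mul]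
    refine (hR _ (f g)).trans (le_of_eq ?_)
    rw [← hP, hf]
    rfl
  refine ⟨L₀.extendOfNorm D.subtype, fun i k => ?_, fun g => ?_⟩
  · exact (LinearMap.extendOfNorm_eq hDr ⟨1, hb₀⟩ ⟨P i k, i, k, rfl⟩).trans
      (key ⟨P i k, i, k, rfl⟩ i k rfl)
  · simpa using LinearMap.norm_extendOfNorm_apply_le hDr 1 hb₀ g

/-! ### Systems of root extensions -/

/-- A system of root extensions `({A_α}, {X_α}, {π_{α,β}})`, `0 ≤ α ≤ β ≤ τ`. Only the data at
indices `≤ τ` matter: for convenience `X`, `A`, `F` and `proj` take arbitrary ordinals as arguments,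
but no condition is imposed on them beyond `τ`.

The `F_α`-extension and the inverse limit are used up to canonical identification: the
identification of `X_{α+1}` with the space `(X_α)_{F_α}` is part of the data, and for a limit
ordinal `γ` the canonical map from `X_γ` to the product of the `X_α`, `α < γ`, is a homeomorphism
onto the space of compatible families, i.e. onto the inverse limit. -/
structure RootSystem (τ : Ordinal.{v}) where
  /-- The spaces `X_α`. -/
  X : Ordinal.{v} → Type u
  [top : ∀ α, TopologicalSpace (X α)]
  [compact : ∀ α, CompactSpace (X α)]
  [t2 : ∀ α, T2Space (X α)]
  /-- The algebras `A_α`. -/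
  A : ∀ α, Subalgebra ℂ C(X α, ℂ)
  /-- The maps `π_{α,β} : X_β → X_α`. -/
  proj : ∀ {α β : Ordinal.{v}}, α ≤ β → C(X β, X α)
  /-- The sets `F_α ⊆ A_α` of functions to which square roots are adjoined. -/
  F : ∀ α, Set (A α)
  uniform : ∀ α ≤ τ, IsUniformAlgebra (A α)
  proj_surjective : ∀ {α β : Ordinal.{v}} (h : α ≤ β), β ≤ τ → Function.Surjective (proj h)
  comp_mem : ∀ {α β : Ordinal.{v}} (h : α ≤ β), β ≤ τ → ∀ f ∈ A α, f.comp (proj h) ∈ A β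
  proj_refl : ∀ α ≤ τ, proj (le_refl α) = ContinuousMap.id (X α)
  proj_comp : ∀ {α β γ : Ordinal.{v}} (h : α ≤ β) (h' : β ≤ γ), γ ≤ τ →
    (proj h).comp (proj h') = proj (h.trans h')
  /-- The identification of `X_{α+1}` with `(X_α)_{F_α}`. -/
  rootHomeo : ∀ α < τ, X (α + 1) ≃ₜ RootSpace (F α)
  proj_rootHomeo : ∀ (α : Ordinal.{v}) (h : α < τ) (h' : α ≤ α + 1) (y : X (α + 1)),
    RootSpace.proj (F α) (rootHomeo α h y) = proj h' y
  comp_rootHomeo_mem_iff : ∀ (α : Ordinal.{v}) (h : α < τ) (g : C(RootSpace (F α), ℂ)),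
    g.comp (rootHomeo α h : C(X (α + 1), RootSpace (F α))) ∈ A (α + 1) ↔ g ∈ rootAlgebra (F α)
  limit_isEmbedding : ∀ (γ : Ordinal.{v}), Order.IsSuccLimit γ → γ ≤ τ →
    IsEmbedding fun (y : X γ) (α : Set.Iio γ) => proj (le_of_lt (Set.mem_Iio.mp α.2)) y
  limit_range : ∀ (γ : Ordinal.{v}), Order.IsSuccLimit γ → γ ≤ τ →
    Set.range (fun (y : X γ) (α : Set.Iio γ) => proj (le_of_lt (Set.mem_Iio.mp α.2)) y) =
      {t | ∀ (α β : Set.Iio γ) (h : (α : Ordinal.{v}) ≤ β), proj h (t β) = t α}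
  limit_closure : ∀ (γ : Ordinal.{v}), Order.IsSuccLimit γ → γ ≤ τ →
    (A γ : Set C(X γ, ℂ)) =
      closure {g | ∃ (α : Ordinal.{v}) (h : α < γ), ∃ f ∈ A α, g = f.comp (proj h.le)}

namespace RootSystem

attribute [instance] RootSystem.top RootSystem.compact RootSystem.t2

variable {τ : Ordinal.{v}} (S : RootSystem.{u, v} τ)

/-- The isometric embedding `π*_{α,β} : A_α → A_β`, `f ↦ f ∘ π_{α,β}`. -/
def pullback {α β : Ordinal.{v}} (h : α ≤ β) (hβ : β ≤ τ) : S.A α →ₐ[ℂ] S.A β where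
  toFun f := ⟨(f : C(S.X α, ℂ)).comp (S.proj h), S.comp_mem h hβ f f.2⟩
  map_one' := rfl
  map_mul' _ _ := rfl
  map_zero' := rfl
  map_add' _ _ := rfl
  commutes' _ := rfl

theorem norm_pullback {α β : Ordinal.{v}} (h : α ≤ β) (hβ : β ≤ τ) (f : S.A α) :
    ‖S.pullback h hβ f‖ = ‖f‖ := by
  refine le_antisymm ((ContinuousMap.norm_le _ (norm_nonneg _)).mpr fun x => ?_)
    ((ContinuousMap.norm_le _ (norm_nonneg _)).mpr fun x => ?_)
  · exact ContinuousMap.norm_coe_le_norm (f : C(S.X α, ℂ)) _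
  · obtain ⟨y, rfl⟩ := S.proj_surjective h hβ x
    exact ContinuousMap.norm_coe_le_norm (S.pullback h hβ f : C(S.X β, ℂ)) y

theorem pullback_refl {α : Ordinal.{v}} (hα : α ≤ τ) (f : S.A α) :
    S.pullback le_rfl hα f = f := by
  refine Subtype.ext (ContinuousMap.ext fun x => ?_)
  change (f : C(S.X α, ℂ)) (S.proj le_rfl x) = _
  rw [S.proj_refl α hα]
  rfl

theorem pullback_pullback {α β γ : Ordinal.{v}} (h : α ≤ β) (h' : β ≤ γ) (hγ : γ ≤ τ) (f : S.A α) :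
    S.pullback h' hγ (S.pullback h (h'.trans hγ) f) = S.pullback (h.trans h') hγ f := by
  refine Subtype.ext (ContinuousMap.ext fun x => ?_)
  change (f : C(S.X α, ℂ)) (S.proj h (S.proj h' x)) = (f : C(S.X α, ℂ)) (S.proj (h.trans h') x)
  rw [← S.proj_comp h h' hγ]
  rfl

/-- The identification of `A_{α+1}` with the `F_α`-extension of `A_α`. -/
def toRootAlgebra (α : Ordinal.{v}) (h : α < τ) : S.A (α + 1) →L[ℂ] rootAlgebra (S.F α) :=
  LinearMap.mkContinuous
    { toFun := fun g =>
        ⟨(g : C(S.X (α + 1), ℂ)).comp ((S.rootHomeo α h).symm : C(RootSpace (S.F α), S.X (α + 1))),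
          (S.comp_rootHomeo_mem_iff α h _).mp (by
            convert g.2 using 1
            ext x
            simp)⟩
      map_add' := fun _ _ => rfl
      map_smul' := fun _ _ => rfl } 1
    (fun g => by
      rw [one_mul]
      exact (ContinuousMap.norm_le _ (norm_nonneg _)).mpr fun x =>
        ContinuousMap.norm_coe_le_norm (g : C(S.X (α + 1), ℂ)) _)

/-- The fiber averaging operator `T_{α,α+1} : A_{α+1} → A_α` of a single root extension. -/
def stepAverage (α : Ordinal.{v}) (h : α < τ) : S.A (α + 1) →L[ℂ] S.A α :=
  (rootAverage (S.uniform α h.le).isClosed (S.F α)).comp (S.toRootAlgebra α h)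

theorem norm_stepAverage_le (α : Ordinal.{v}) (h : α < τ) (g : S.A (α + 1)) :
    ‖S.stepAverage α h g‖ ≤ ‖g‖ := by
  refine (norm_rootAverage_le (S.uniform α h.le).isClosed (S.F α) (S.toRootAlgebra α h g)).trans ?_
  exact (ContinuousMap.norm_le _ (norm_nonneg _)).mpr fun x =>
        ContinuousMap.norm_coe_le_norm (g : C(S.X (α + 1), ℂ)) _

theorem stepAverage_pullback (α : Ordinal.{v}) (h : α < τ) (h1 : α ≤ α + 1) (h2 : α + 1 ≤ τ)
    (f : S.A α) : S.stepAverage α h (S.pullback h1 h2 f) = f := by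
  refine Subtype.ext (ContinuousMap.ext fun x => ?_)
  change (rootAverage (S.uniform α h.le).isClosed (S.F α)
    (S.toRootAlgebra α h (S.pullback h1 h2 f)) : C(S.X α, ℂ)) x = _
  rw [rootAverage_apply, ← fiberAverage_comp_proj (F := S.F α) (f : C(S.X α, ℂ)) x]
  congr 1
  ext y
  change (f : C(S.X α, ℂ)) (S.proj h1 ((S.rootHomeo α h).symm y)) = _
  rw [← S.proj_rootHomeo α h]
  simp

open Classical in
/-- The operators `T_{0,α} : A_α → A_0`, by transfinite recursion: `T_{0,0}` is the identity,
`T_{0,α+1} = T_{0,α} ∘ T_{α,α+1}`, and for a limit ordinal `γ`, `T_{0,γ}` is the continuous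
operator with `T_{0,γ} ∘ π*_{β,γ} = T_{0,β}` for all `β < γ`. Such an operator exists and is unique,
see `T_pullback` and `eq_of_comp_pullback_eq`, so the value `0` in the last line is never used. -/
def T (α : Ordinal.{v}) : α ≤ τ → (S.A α →L[ℂ] S.A 0) :=
  Ordinal.limitRecOn (motive := fun α => α ≤ τ → (S.A α →L[ℂ] S.A 0)) α
    (fun _ => ContinuousLinearMap.id ℂ (S.A 0))
    (fun α Tα h => (Tα ((Order.le_succ α).trans h)).comp
      (S.stepAverage α ((Order.lt_succ α).trans_le h)))
    (fun γ _ Tlt h =>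
      if hL : ∃ L : S.A γ →L[ℂ] S.A 0, ∀ (β : Ordinal.{v}) (hβ : β < γ) (f : S.A β),
          L (S.pullback hβ.le h f) = Tlt β hβ (hβ.le.trans h) f
      then hL.choose else 0)

theorem T_zero (h : 0 ≤ τ) : S.T 0 h = ContinuousLinearMap.id ℂ (S.A 0) := by
  simp [T]

theorem T_add_one (α : Ordinal.{v}) (h : α < τ) (h' : α + 1 ≤ τ) :
    S.T (α + 1) h' = (S.T α h.le).comp (S.stepAverage α h) := by
  simp [T]

theorem dense_pullback {γ : Ordinal.{v}} (hγ : Order.IsSuccLimit γ) (h : γ ≤ τ) :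
    Dense {g : S.A γ | ∃ (β : Set.Iio γ) (f : S.A β),
      S.pullback (le_of_lt (Set.mem_Iio.mp β.2)) h f = g} := by
  intro g
  rw [Metric.mem_closure_iff]
  intro ε hε
  have hg : (g : C(S.X γ, ℂ)) ∈ (S.A γ : Set C(S.X γ, ℂ)) := g.2
  rw [S.limit_closure γ hγ h, Metric.mem_closure_iff] at hg
  obtain ⟨_, ⟨β, hβ, f, hf, rfl⟩, hd⟩ := hg ε hε
  exact ⟨S.pullback hβ.le h ⟨f, hf⟩, ⟨⟨β, hβ⟩, ⟨f, hf⟩, rfl⟩, hd⟩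

theorem eq_of_comp_pullback_eq {γ : Ordinal.{v}} (hγ : Order.IsSuccLimit γ) (h : γ ≤ τ)
    {L L' : S.A γ →L[ℂ] S.A 0}
    (hL : ∀ (β : Ordinal.{v}) (hβ : β < γ) (f : S.A β),
      L (S.pullback hβ.le h f) = L' (S.pullback hβ.le h f)) : L = L' := by
  refine DFunLike.coe_injective (Continuous.ext_on (S.dense_pullback hγ h) L.continuous
    L'.continuous ?_)
  rintro _ ⟨β, f, rfl⟩
  exact hL β β.2 f

open Classical in
theorem T_of_isSuccLimit {γ : Ordinal.{v}} (hγ : Order.IsSuccLimit γ) (h : γ ≤ τ) :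
    S.T γ h = if hL : ∃ L : S.A γ →L[ℂ] S.A 0, ∀ (β : Ordinal.{v}) (hβ : β < γ) (f : S.A β),
          L (S.pullback hβ.le h f) = S.T β (hβ.le.trans h) f
      then hL.choose else 0 := by
  rw [T, Ordinal.limitRecOn_limit _ _ _ _ hγ]
  rfl

theorem T_pullback_and_norm_le (β : Ordinal.{v}) : ∀ h : β ≤ τ,
    (∀ (α : Ordinal.{v}) (hα : α ≤ β) (f : S.A α),
      S.T β h (S.pullback hα h f) = S.T α (hα.trans h) f) ∧ ∀ g, ‖S.T β h g‖ ≤ ‖g‖ := by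
  induction β using Ordinal.limitRecOn with
  | zero =>
    intro h
    refine ⟨fun α hα f => ?_, fun g => by rw [T_zero]; exact le_rfl⟩
    obtain rfl : α = 0 := le_antisymm hα zero_le
    rw [pullback_refl]
  | add_one β ih =>
    intro h
    have hβ : β < τ := (Order.lt_succ β).trans_le h
    obtain ⟨ih1, ih2⟩ := ih hβ.le
    refine ⟨fun α hα f => ?_, fun g => ?_⟩
    · rcases hα.lt_or_eq with hlt | rfl
      · have hα' : α ≤ β := Order.lt_succ_iff.mp hlt
        have hs : β ≤ β + 1 := Order.le_succ β
        rw [← S.pullback_pullback hα' hs h, T_add_one _ _ hβ,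
          ContinuousLinearMap.comp_apply, stepAverage_pullback, ih1]
      · rw [pullback_refl]
    · rw [T_add_one _ _ hβ]
      exact (ih2 _).trans (S.norm_stepAverage_le β hβ g)
  | limit γ hγ ih =>
    intro h
    have : CompleteSpace (S.A 0) :=
      (S.uniform 0 (zero_le.trans h)).isClosed.completeSpace_coe
    have : Nonempty (Set.Iio γ) := ⟨⟨0, hγ.bot_lt⟩⟩
    have hle : ∀ β : Set.Iio γ, (β : Ordinal.{v}) ≤ γ := fun β => le_of_lt (Set.mem_Iio.mp β.2)
    obtain ⟨L, hL', hLn⟩ := exists_contraction_extension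
      (fun β : Set.Iio γ => (S.pullback (hle β) h).toLinearMap)
      (fun α β hα => (S.pullback hα ((hle β).trans h)).toLinearMap)
      (fun β => (S.T β ((hle β).trans h)).toLinearMap)
      (fun β f => S.norm_pullback (hle β) h f)
      (fun α β hα f => S.pullback_pullback hα (hle β) h f)
      (fun α β hα f => (ih β β.2 ((hle β).trans h)).1 α hα f)
      (fun β f => (ih β β.2 ((hle β).trans h)).2 f)
      (S.dense_pullback hγ h)
    have hL : ∀ (β : Ordinal.{v}) (hβ : β < γ) (f : S.A β),
      L (S.pullback hβ.le h f) = S.T β (hβ.le.trans h) f := fun β hβ f => hL' ⟨β, hβ⟩ f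
    have hex : ∃ L : S.A γ →L[ℂ] S.A 0, ∀ (β : Ordinal.{v}) (hβ : β < γ) (f : S.A β),
      L (S.pullback hβ.le h f) = S.T β (hβ.le.trans h) f := ⟨L, hL⟩
    have hT : S.T γ h = L := by
      rw [T_of_isSuccLimit _ hγ, dif_pos hex]
      exact S.eq_of_comp_pullback_eq hγ h fun β hβ f =>
        (hex.choose_spec β hβ f).trans (hL β hβ f).symm
    refine ⟨fun α hα f => ?_, fun g => hT ▸ hLn g⟩
    rcases hα.lt_or_eq with hlt | rfl
    · rw [hT, hL α hlt]
    · rw [pullback_refl]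

/-- `T_{0,β} ∘ π*_{α,β} = T_{0,α}` for `α ≤ β`; in particular at limit ordinals `β`. -/
theorem T_pullback {α β : Ordinal.{v}} (hα : α ≤ β) (h : β ≤ τ) (f : S.A α) :
    S.T β h (S.pullback hα h f) = S.T α (hα.trans h) f :=
  (S.T_pullback_and_norm_le β h).1 α hα f

/-- The set `I_α = T_{0,α}⁻¹(I_0)`. -/
def liftSet (I₀ : Ideal (S.A 0)) (α : Ordinal.{v}) (h : α ≤ τ) : Set (S.A α) :=
  S.T α h ⁻¹' (I₀ : Set (S.A 0))

/-- The set `S_α = π_{0,α}⁻¹(S_0)` with `S_0 = hull(I_0)`. -/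
def liftHull (I₀ : Ideal (S.A 0)) (α : Ordinal.{v}) : Set (S.X α) :=
  S.proj zero_le ⁻¹' hull I₀

instance (I₀ : Ideal (S.A 0)) : CompactSpace (hull I₀) :=
  isCompact_iff_compactSpace.mp (isClosed_hull I₀).isCompact

instance (I₀ : Ideal (S.A 0)) (α : Ordinal.{v}) : CompactSpace (S.liftHull I₀ α) :=
  isCompact_iff_compactSpace.mp
    ((isClosed_hull I₀).preimage (S.proj zero_le).continuous).isCompact

end RootSystem

/-- The quotient norm on `A / J` (Mathlib's instance, repeated to shorten the instance search). -/
instance {X : Type*} [TopologicalSpace X] [CompactSpace X] {A : Subalgebra ℂ C(X, ℂ)}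
    (J : Ideal A) : Norm (A ⧸ J) :=
  (Ideal.Quotient.semiNormedCommRing J).toNorm

/-- The closed ideals of `A` that contain `J`, ordered by inclusion. -/
abbrev ClosedIdealsAbove {X : Type*} [TopologicalSpace X] [CompactSpace X]
    {A : Subalgebra ℂ C(X, ℂ)} (J : Ideal A) : Type _ :=
  {K : Ideal A // IsClosed (K : Set A) ∧ J ≤ K}

end

/-! Write `P` for the pullback `A_0 → A_α` and `T` for `T_{0,α}`. `P` is an isometric homomorphism
and `T` a contractive linear map with `T ∘ P = id`. The theorem rests on two facts, both proved by
transfinite induction.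

`T_mul_sub_mem`: `T` is multiplicative modulo `I_0`. Hence `g ↦ T g + I_0` is an algebra
homomorphism of `A_α` onto `A_0 / I_0` with kernel `I_α`. So `I_α` is a closed ideal, the induced
isomorphism of quotients is isometric because `T` and `P` are both contractive, and closed ideals
correspond under `P⁻¹` and `T⁻¹`.

`T_apply_proj`: on `S_α`, every `g ∈ A_α` agrees with `(T g) ∘ π_{0,α}`. Points of `S_α` with the
same image in `S_0` therefore cannot be separated by `A_α`, every restriction to `S_α` comes from
`A_0`, and elements of `I_α` vanish on `S_α`.

At a successor step both facts come from `F_α ⊆ I_α`. Averaging kills every monomial `(f ∘ π) ∏ p_i`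
with at least one root; a product of two such monomials survives only if they involve the same
roots, and is then the pullback of a multiple of an element of `F_α` (`fiberAverage_mul_rootSpan`).
Moreover `F_α` vanishes on `S_α`, so the fibers over `S_α` are single points and averaging is
evaluation. At a limit step, continuity and density of the earlier algebras suffice. -/

noncomputable section

/-! ### Contractive retractions that are multiplicative modulo an ideal -/

section Retraction

variable {A B : Type*} [NormedCommRing A] [NormedAlgebra ℂ A] [NormedCommRing B]
  [NormedAlgebra ℂ B]

/-- A linear map that is multiplicative modulo `I`, as an algebra homomorphism to the quotient. -/
def quotientAlgHom (T : B →L[ℂ] A) (I : Ideal A) (h1 : T 1 = 1)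
    (hmul : ∀ g h, T (g * h) - T g * T h ∈ I) : B →ₐ[ℂ] A ⧸ I :=
  AlgHom.ofLinearMap ((Ideal.Quotient.mkₐ ℂ I).toLinearMap ∘ₗ T.toLinearMap)
    (by simp [h1]) (fun g h => by
      simp only [LinearMap.comp_apply, AlgHom.toLinearMap_apply, Ideal.Quotient.mkₐ_eq_mk]
      rw [← map_mul]
      exact Ideal.Quotient.eq.mpr (hmul g h))

theorem quotientAlgHom_apply (T : B →L[ℂ] A) (I : Ideal A) (h1 : T 1 = 1)
    (hmul : ∀ g h, T (g * h) - T g * T h ∈ I) (g : B) :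
    quotientAlgHom T I h1 hmul g = Ideal.Quotient.mk I (T g) := rfl

/-- This is what makes the preimage of `I` under the merely linear map `T` an ideal of `B`. -/
theorem mem_ker_quotientAlgHom (T : B →L[ℂ] A) (I : Ideal A) (h1 : T 1 = 1)
    (hmul : ∀ g h, T (g * h) - T g * T h ∈ I) (g : B) :
    g ∈ RingHom.ker (quotientAlgHom T I h1 hmul) ↔ T g ∈ I := by
  rw [RingHom.mem_ker, quotientAlgHom_apply, Ideal.Quotient.eq_zero_iff_mem]

theorem quotientAlgHom_surjective (P : A →ₐ[ℂ] B) (T : B →L[ℂ] A) (I : Ideal A)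
    (hTP : ∀ f, T (P f) = f) (h1 : T 1 = 1) (hmul : ∀ g h, T (g * h) - T g * T h ∈ I) :
    Function.Surjective (quotientAlgHom T I h1 hmul) := by
  intro x
  obtain ⟨f, rfl⟩ := Ideal.Quotient.mk_surjective x
  exact ⟨P f, by rw [quotientAlgHom_apply, hTP]⟩

/-- Multiplicativity modulo a closed ideal need only be checked on a dense set. -/
theorem map_mul_sub_mem_of_dense (T : B →L[ℂ] A) {I : Ideal A} (hI : IsClosed (I : Set A))
    {D : Set B} (hD : Dense D) (h : ∀ f ∈ D, ∀ g ∈ D, T (f * g) - T f * T g ∈ I) (f g : B) :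
    T (f * g) - T f * T g ∈ I := by
  have hc : Continuous fun p : B × B => T (p.1 * p.2) - T p.1 * T p.2 := by fun_prop
  exact closure_minimal (fun p hp => h p.1 hp.1 p.2 hp.2) (hI.preimage hc) ((hD.prod hD) (f, g))

/-- A contractive retraction `T` of an isometric homomorphism `P` that is multiplicative modulo `I`
induces an isometric isomorphism of quotients. -/
theorem exists_isometric_quotient_equiv (P : A →ₐ[ℂ] B) (T : B →L[ℂ] A) (I : Ideal A)
    (hP : ∀ f, ‖P f‖ = ‖f‖) (hT : ∀ g, ‖T g‖ ≤ ‖g‖) (hTP : ∀ f, T (P f) = f) (h1 : T 1 = 1)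
    (hmul : ∀ g h, T (g * h) - T g * T h ∈ I) :
    ∃ Ψ : (B ⧸ RingHom.ker (quotientAlgHom T I h1 hmul)) ≃ₐ[ℂ] (A ⧸ I), ∀ x, ‖Ψ x‖ = ‖x‖ := by
  let Ψ := Ideal.quotientKerAlgEquivOfSurjective (quotientAlgHom_surjective P T I hTP h1 hmul)
  have hΨ : ∀ g, Ψ (Ideal.Quotient.mk _ g) = Ideal.Quotient.mk I (T g) := fun g => rfl
  refine ⟨Ψ, fun x => le_antisymm ?_ ?_⟩
  -- Lift `x` to an almost norm-minimal `g` in `B`; `T` does not increase its norm.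
  · refine le_of_forall_pos_le_add fun ε hε => ?_
    obtain ⟨g, rfl, hg⟩ := Ideal.Quotient.norm_mk_lt x hε
    rw [hΨ]
    exact (Ideal.Quotient.norm_mk_le I (T g)).trans ((hT g).trans hg.le)
  -- Conversely, lift `Ψ x` to an almost norm-minimal `f` in `A`; since `T (P f) = f`, the element
  -- `P f` of equal norm represents `x`.
  · refine le_of_forall_pos_le_add fun ε hε => ?_
    obtain ⟨f, hf, hfn⟩ := Ideal.Quotient.norm_mk_lt (Ψ x) hε
    have hx : x = Ideal.Quotient.mk _ (P f) := Ψ.injective (by rw [hΨ, hTP, hf])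
    rw [hx] at hfn ⊢
    exact (Ideal.Quotient.norm_mk_le _ (P f)).trans ((hP f).le.trans hfn.le)

/-- The correspondence of closed ideals for a retraction that is multiplicative modulo `I`. -/
def closedIdealsOrderIso (P : A →ₐ[ℂ] B) (hPc : Continuous P) (T : B →L[ℂ] A) (I : Ideal A)
    (hTP : ∀ f, T (P f) = f) (h1 : T 1 = 1) (hmul : ∀ g h, T (g * h) - T g * T h ∈ I) :
    {K : Ideal B // IsClosed (K : Set B) ∧ RingHom.ker (quotientAlgHom T I h1 hmul) ≤ K} ≃o
      {L : Ideal A // IsClosed (L : Set A) ∧ I ≤ L} :=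
  -- Multiplicativity modulo `I` implies multiplicativity modulo any larger `L`, so the inverse map
  -- `L ↦ T⁻¹(L)` can again be written as a kernel.
  have hmem : ∀ (L : Ideal A) (hL : I ≤ L) (g : B),
      g ∈ RingHom.ker (quotientAlgHom T L h1 fun g h => hL (hmul g h)) ↔ T g ∈ L :=
    fun L hL g => mem_ker_quotientAlgHom T L h1 _ g
  -- `T` annihilates `g - P (T g)`, so this difference lies in `K`; membership in `K` thus depends
  -- on `T g` only.
  have hiff : ∀ K : Ideal B, RingHom.ker (quotientAlgHom T I h1 hmul) ≤ K →
      ∀ g, P (T g) ∈ K ↔ g ∈ K := fun K hK g => by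
    have h : g - P (T g) ∈ K := hK (by
      rw [mem_ker_quotientAlgHom, map_sub, hTP, sub_self]
      exact I.zero_mem)
    exact ⟨fun hg => by simpa using K.add_mem h hg, fun hg => by simpa using K.sub_mem hg h⟩
  { toFun := fun K => ⟨K.1.comap P, K.2.1.preimage hPc, fun f hf => K.2.2 (by
      rw [mem_ker_quotientAlgHom, hTP]
      exact hf)⟩
    invFun := fun L => ⟨RingHom.ker (quotientAlgHom T L.1 h1 fun g h => L.2.2 (hmul g h)), by
        convert L.2.1.preimage T.continuous using 1
        ext g
        exact hmem L.1 L.2.2 g, fun g hg => by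
        rw [hmem L.1 L.2.2]
        exact L.2.2 ((mem_ker_quotientAlgHom T I h1 hmul g).mp hg)⟩
    left_inv := fun K => Subtype.ext (Ideal.ext fun g =>
      (mem_ker_quotientAlgHom T _ h1 _ g).trans (hiff K.1 K.2.2 g))
    right_inv := fun L => Subtype.ext (Ideal.ext fun f => by
      refine (mem_ker_quotientAlgHom T _ h1 _ (P f)).trans ?_
      rw [hTP])
    map_rel_iff' := fun {K K'} => ⟨fun h g hg => (hiff K'.1 K'.2.2 g).mp
      (h ((hiff K.1 K.2.2 g).mpr hg : T g ∈ K.1.comap P)), fun h => Ideal.comap_mono h⟩ }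

end Retraction

/-! ### Fiber averaging over a single root extension, modulo an ideal -/

section RootExtension

variable {X : Type*} [TopologicalSpace X] {A : Subalgebra ℂ C(X, ℂ)}

/-- The factor `f ∘ π` is constant on each orbit of sign changes, so it leaves the integral. -/
theorem fiberAverage_comp_proj_mul {F : Set A} (f : C(X, ℂ)) (g : C(RootSpace F, ℂ)) (x : X) :
    fiberAverage (f.comp (RootSpace.proj F) * g) x = f x * fiberAverage g x :=
  integral_const_mul (f x) _

/-- Over a common zero of `F`, the fiber average of `g` is the value of `g`. -/
theorem fiberAverage_eq_of_forall_eq_zero {F : Set A} (g : C(RootSpace F, ℂ)) (y : RootSpace F)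
    (hy : ∀ f : F, (f.1 : C(X, ℂ)) (RootSpace.proj F y) = 0) :
    fiberAverage g (RootSpace.proj F y) = g y := by
  have h : ∀ s, RootSpace.act s y = y := fun s => by
    refine Subtype.ext (Prod.ext rfl (funext fun f => ?_))
    have h0 : y.1.2 f = 0 := pow_eq_zero_iff two_ne_zero |>.mp ((y.2 f).trans (hy f))
    change _ * y.1.2 f = y.1.2 f
    rw [h0, mul_zero]
  simp [fiberAverage_proj, h]

-- Roots occurring in both products pair up to squares, which are pulled back from `X`; the
-- remaining ones are indexed by the symmetric difference. This decides which products of monomials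
-- survive averaging.
open Classical in
theorem prod_root_mul_prod_root {F : Set A} (s t : Finset F) :
    (∏ i ∈ s, RootSpace.root i) * (∏ i ∈ t, RootSpace.root i) =
      (∏ i ∈ s ∩ t, (i.1 : C(X, ℂ))).comp (RootSpace.proj F) *
        ∏ i ∈ symmDiff s t, RootSpace.root i := by
  have hk : (∏ i ∈ s ∩ t, (i.1 : C(X, ℂ))).comp (RootSpace.proj F) =
      (∏ i ∈ s ∩ t, RootSpace.root i) * ∏ i ∈ s ∩ t, RootSpace.root i := by
    ext y
    simp only [ContinuousMap.prod_apply, ContinuousMap.comp_apply, ContinuousMap.mul_apply]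
    rw [← Finset.prod_mul_distrib]
    refine Finset.prod_congr rfl fun i _ => ?_
    rw [← sq]
    exact (y.2 i).symm
  rw [hk, symmDiff_def, Finset.sup_eq_union, Finset.prod_union disjoint_sdiff_sdiff,
    ← Finset.prod_inter_mul_prod_sdiff s t, ← Finset.prod_inter_mul_prod_sdiff t s,
    Finset.inter_comm t s]
  ring

open Classical in
/-- If `F` lies in the ideal `I`, fiber averaging is multiplicative modulo `I` on `rootSpan F`. -/
theorem fiberAverage_mul_rootSpan {F : Set A} {I : Ideal A} (hF : F ⊆ I) {g h : C(RootSpace F, ℂ)}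
    (hg : g ∈ rootSpan F) (hh : h ∈ rootSpan F) :
    ∃ k ∈ I, ∀ x, (k : C(X, ℂ)) x =
      fiberAverage (g * h) x - fiberAverage g x * fiberAverage h x := by
  induction hg using Submodule.span_induction generalizing h with
  | mem g hg =>
    obtain ⟨f, hf, s, rfl⟩ := hg
    induction hh using Submodule.span_induction with
    | mem h hh =>
      obtain ⟨f', hf', t, rfl⟩ := hh
      -- Without roots the first factor is a pullback, and averaging is exactly linear over
      -- pullbacks.
      rcases s.eq_empty_or_nonempty with rfl | hs
      · refine ⟨0, I.zero_mem, fun x => ?_⟩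
        simp [fiberAverage_comp_proj_mul, fiberAverage_comp_proj]
      have hgh : f.comp (RootSpace.proj F) * (∏ i ∈ s, RootSpace.root i) *
          (f'.comp (RootSpace.proj F) * ∏ i ∈ t, RootSpace.root i) =
          (f * f' * ∏ i ∈ s ∩ t, (i.1 : C(X, ℂ))).comp (RootSpace.proj F) *
            ∏ i ∈ symmDiff s t, RootSpace.root i := by
        have h := prod_root_mul_prod_root s t
        have h2 : (f * f' * ∏ i ∈ s ∩ t, (i.1 : C(X, ℂ))).comp (RootSpace.proj F) =
          f.comp (RootSpace.proj F) * f'.comp (RootSpace.proj F) *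
            (∏ i ∈ s ∩ t, (i.1 : C(X, ℂ))).comp (RootSpace.proj F) := rfl
        rw [h2]
        linear_combination (f.comp (RootSpace.proj F) * f'.comp (RootSpace.proj F)) * h
      simp only [hgh, fiberAverage_monomial f s hs, zero_mul, sub_zero]
      -- The average of the first factor is zero, so only the average of the product is left. If `s
      -- = t`, it is a multiple of some `i ∈ F ⊆ I`; otherwise an unpaired root makes it zero.
      rcases (symmDiff s t).eq_empty_or_nonempty with he | hne
      · obtain rfl : s = t := symmDiff_eq_bot.mp he
        obtain ⟨i, hi⟩ := hs
        refine ⟨(⟨f, hf⟩ * ⟨f', hf'⟩) * ∏ i ∈ s, i.1,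
          I.mul_mem_left _ (I.mem_of_dvd (Finset.dvd_prod_of_mem _ hi) (hF i.2)), fun x => ?_⟩
        rw [he, Finset.prod_empty, mul_one, fiberAverage_comp_proj, Finset.inter_self]
        simp [SubmonoidClass.coe_finsetProd]
      · exact ⟨0, I.zero_mem, fun x => by rw [fiberAverage_monomial _ _ hne]; rfl⟩
    | zero => exact ⟨0, I.zero_mem, fun x => by simp [fiberAverage]⟩
    | add h h' _ _ ih ih' =>
      obtain ⟨k, hk, e⟩ := ih
      obtain ⟨k', hk', e'⟩ := ih'
      refine ⟨k + k', I.add_mem hk hk', fun x => ?_⟩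
      simp only [mul_add, fiberAverage_add, AddMemClass.coe_add, ContinuousMap.add_apply, e, e']
      ring
    | smul c h _ ih =>
      obtain ⟨k, hk, e⟩ := ih
      refine ⟨c • k, I.smul_of_tower_mem c hk, fun x => ?_⟩
      simp only [mul_smul_comm, fiberAverage_smul, Subalgebra.coe_smul, ContinuousMap.smul_apply,
        smul_eq_mul, e]
      ring
  | zero => exact ⟨0, I.zero_mem, fun x => by simp [fiberAverage]⟩
  | add g g' _ _ ih ih' =>
    obtain ⟨k, hk, e⟩ := ih hh
    obtain ⟨k', hk', e'⟩ := ih' hh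
    refine ⟨k + k', I.add_mem hk hk', fun x => ?_⟩
    simp only [add_mul, fiberAverage_add, AddMemClass.coe_add, ContinuousMap.add_apply, e, e']
    ring
  | smul c g _ ih =>
    obtain ⟨k, hk, e⟩ := ih hh
    refine ⟨c • k, I.smul_of_tower_mem c hk, fun x => ?_⟩
    simp only [smul_mul_assoc, fiberAverage_smul, Subalgebra.coe_smul, ContinuousMap.smul_apply,
      smul_eq_mul, e]
    ring

end RootExtension

/-! ### From the span of monomials to the closed algebra -/

section RootExtension

variable {X : Type*} [TopologicalSpace X] {A : Subalgebra ℂ C(X, ℂ)}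

/-- If `F` lies in the closed ideal `I`, fiber averaging is multiplicative modulo `I`. -/
theorem rootAverage_mul_sub_mem [CompactSpace X] (hA : IsClosed (A : Set C(X, ℂ))) {F : Set A}
    {I : Ideal A} (hI : IsClosed (I : Set A)) (hF : F ⊆ I) (g h : rootAlgebra F) :
    rootAverage hA F (g * h) - rootAverage hA F g * rootAverage hA F h ∈ I := by
  let D : Set (rootAlgebra F) := {g | (g : C(RootSpace F, ℂ)) ∈ rootSpan F}
  have hD : Dense D := by
    intro g
    rw [Metric.mem_closure_iff]
    intro ε hε
    obtain ⟨k, hk, hd⟩ := Metric.mem_closure_iff.mp g.2 ε hε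
    exact ⟨⟨k, subset_closure hk⟩, adjoin_subset_rootSpan hk, hd⟩
  refine map_mul_sub_mem_of_dense _ hI hD (fun g hg h hh => ?_) g h
  obtain ⟨k, hk, e⟩ := fiberAverage_mul_rootSpan hF hg hh
  convert hk using 1
  refine Subtype.ext (ContinuousMap.ext fun x => ?_)
  simp [rootAverage_apply, e]

end RootExtension

/-! ### Transfinite induction along the system -/

namespace RootSystem

variable {τ : Ordinal.{v}} (S : RootSystem.{u, v} τ)

theorem stepAverage_eq (α : Ordinal.{v}) (h : α < τ) (g : S.A (α + 1)) :
    S.stepAverage α h g =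
      rootAverage (S.uniform α h.le).isClosed (S.F α) (S.toRootAlgebra α h g) := rfl

theorem toRootAlgebra_mul (α : Ordinal.{v}) (h : α < τ) (g k : S.A (α + 1)) :
    S.toRootAlgebra α h (g * k) = S.toRootAlgebra α h g * S.toRootAlgebra α h k := rfl

theorem T_one {α : Ordinal.{v}} (h : α ≤ τ) : S.T α h 1 = 1 := by
  rw [← map_one (S.pullback zero_le h), T_pullback, T_zero]
  rfl

theorem T_pullback_zero {α : Ordinal.{v}} (h : α ≤ τ) (f : S.A 0) :
    S.T α h (S.pullback zero_le h f) = f := by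
  rw [T_pullback, T_zero]
  rfl

/-- Modulo `I_0`, the operator `T_{0,α}` is multiplicative. -/
theorem T_mul_sub_mem {I₀ : Ideal (S.A 0)} (hI₀ : IsClosed (I₀ : Set (S.A 0)))
    (hF : ∀ (α : Ordinal.{v}) (hα : α < τ), S.F α ⊆ S.liftSet I₀ α hα.le) (α : Ordinal.{v}) :
    ∀ (hα : α ≤ τ) (g h : S.A α), S.T α hα (g * h) - S.T α hα g * S.T α hα h ∈ I₀ := by
  induction α using Ordinal.limitRecOn with
  | zero =>
    intro h f g
    simp [T_zero]
  | add_one α ih =>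
    intro h f g
    have hα : α < τ := (Order.lt_succ α).trans_le h
    -- By the induction hypothesis `I_α` is the kernel of `φ`, hence a closed ideal containing
    -- `F_α`, and the result for one root extension applies with this ideal.
    let φ := quotientAlgHom (S.T α hα.le) I₀ (S.T_one hα.le) (ih hα.le)
    have hcl : IsClosed (RingHom.ker φ : Set (S.A α)) := by
      convert hI₀.preimage (S.T α hα.le).continuous using 1
      ext g
      exact mem_ker_quotientAlgHom _ _ _ _ g
    have hker := rootAverage_mul_sub_mem (S.uniform α hα.le).isClosed hcl
      (fun f hf => (mem_ker_quotientAlgHom _ _ _ _ f).mpr (hF α hα hf))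
      (S.toRootAlgebra α hα f) (S.toRootAlgebra α hα g)
    rw [← toRootAlgebra_mul, ← stepAverage_eq, ← stepAverage_eq, ← stepAverage_eq,
      mem_ker_quotientAlgHom, map_sub] at hker
    simp only [T_add_one _ _ hα, ContinuousLinearMap.comp_apply]
    -- The defect of the composite is `T_{0,α}` of the defect of the single step, plus the defect of
    -- `T_{0,α}` at the two averages.
    convert I₀.add_mem hker (ih hα.le (S.stepAverage α hα f) (S.stepAverage α hα g)) using 1
    ring
  | limit γ hγ ih =>
    intro h f g
    refine map_mul_sub_mem_of_dense _ hI₀ (S.dense_pullback hγ h) ?_ f g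
    rintro _ ⟨⟨β, hβ⟩, f, rfl⟩ _ ⟨⟨β', hβ'⟩, g, rfl⟩
    -- Both functions come from the common earlier stage `max β β'`, where the induction hypothesis
    -- holds.
    have hm : max β β' < γ := max_lt hβ hβ'
    have key := ih _ hm (hm.le.trans h) (S.pullback (le_max_left β β') (hm.le.trans h) f)
      (S.pullback (le_max_right β β') (hm.le.trans h) g)
    rw [← S.T_pullback hm.le h, ← S.T_pullback hm.le h, ← S.T_pullback hm.le h, map_mul,
      pullback_pullback, pullback_pullback] at key
    exact key

/-- On `S_α`, a function `g ∈ A_α` agrees with the pullback of `T_{0,α} g`. -/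
theorem T_apply_proj {I₀ : Ideal (S.A 0)}
    (hF : ∀ (α : Ordinal.{v}) (hα : α < τ), S.F α ⊆ S.liftSet I₀ α hα.le) (α : Ordinal.{v}) :
    ∀ (hα : α ≤ τ) (g : S.A α), ∀ x ∈ S.liftHull I₀ α,
      (S.T α hα g : C(S.X 0, ℂ)) (S.proj zero_le x) = (g : C(S.X α, ℂ)) x := by
  induction α using Ordinal.limitRecOn with
  | zero =>
    intro h g x _
    rw [T_zero, S.proj_refl 0 h]
    rfl
  | add_one α ih =>
    intro h g x hx
    have hα : α < τ := (Order.lt_succ α).trans_le h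
    have hs : α ≤ α + 1 := Order.le_succ α
    have hpp : S.proj zero_le (S.proj hs x) = S.proj zero_le x :=
      congr($(S.proj_comp zero_le hs h) x)
    have hx' : S.proj hs x ∈ S.liftHull I₀ α := by
      change S.proj zero_le (S.proj hs x) ∈ hull I₀
      rw [hpp]
      exact hx
    -- The induction hypothesis reduces the claim to the average of `g` over the fiber through `x`,
    -- which is a single point provided `F_α` vanishes below `x`.
    rw [T_add_one _ _ hα, ContinuousLinearMap.comp_apply, ← hpp, ih hα.le _ _ hx',
      stepAverage_eq, rootAverage_apply, ← S.proj_rootHomeo α hα hs,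
      fiberAverage_eq_of_forall_eq_zero]
    · change (g : C(S.X (α + 1), ℂ)) ((S.rootHomeo α hα).symm (S.rootHomeo α hα x)) = _
      rw [Homeomorph.symm_apply_apply]
    -- At a point of `S_α`, `f ∈ F_α` takes the value of `T_{0,α} f ∈ I_0` at a point of the hull,
    -- namely zero.
    · intro f
      rw [S.proj_rootHomeo α hα hs, ← ih hα.le _ _ hx', hpp]
      exact hx _ (hF α hα f.2)
  | limit γ hγ ih =>
    intro h g x hx
    -- Both sides are continuous in `g`, so pullbacks from earlier stages suffice.
    have hcl : IsClosed {g : S.A γ |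
        (S.T γ h g : C(S.X 0, ℂ)) (S.proj zero_le x) = (g : C(S.X γ, ℂ)) x} :=
      isClosed_eq ((continuous_eval_const _).comp
          (continuous_subtype_val.comp (S.T γ h).continuous))
        ((continuous_eval_const _).comp continuous_subtype_val)
    refine closure_minimal ?_ hcl (S.dense_pullback hγ h g)
    rintro _ ⟨⟨β, hβ⟩, f, rfl⟩
    have hβ' : β ≤ γ := le_of_lt hβ
    have hpp : S.proj zero_le (S.proj hβ' x) = S.proj zero_le x :=
      congr($(S.proj_comp zero_le hβ' h) x)
    simp only [Set.mem_ofPred_eq]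
    rw [T_pullback, ← hpp]
    refine ih β hβ _ f _ ?_
    change S.proj zero_le (S.proj hβ' x) ∈ hull I₀
    rw [hpp]
    exact hx

/-- The map `π_{0,α}` restricts to a homeomorphism of `S_α` onto `S_0`. -/
theorem exists_homeomorph_liftHull {I₀ : Ideal (S.A 0)}
    (hF : ∀ (α : Ordinal.{v}) (hα : α < τ), S.F α ⊆ S.liftSet I₀ α hα.le) {α : Ordinal.{v}}
    (hα : α ≤ τ) :
    ∃ e : S.liftHull I₀ α ≃ₜ hull I₀, ∀ y, (e y : S.X 0) = S.proj zero_le (y : S.X α) := by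
  let p : S.liftHull I₀ α → hull I₀ := fun y => ⟨S.proj zero_le (y : S.X α), y.2⟩
  have hp : Continuous p :=
    ((S.proj zero_le).continuous.comp continuous_subtype_val).subtype_mk _
  have hinj : Function.Injective p := by
    intro x y hxy
    have hxy' : S.proj zero_le (x : S.X α) = S.proj zero_le (y : S.X α) :=
      congr_arg Subtype.val hxy
    refine Subtype.ext (by_contra fun hne => ?_)
    -- A separating `g` cannot exist: on `S_α` its values are those of `T g` at the common image of
    -- `x` and `y`.
    obtain ⟨_, ⟨g, hg, rfl⟩, hgxy⟩ := (S.uniform α hα).separatesPoints hne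
    refine hgxy ?_
    change (⟨g, hg⟩ : S.A α).1 x = (⟨g, hg⟩ : S.A α).1 y
    rw [← S.T_apply_proj hF α hα _ _ x.2, ← S.T_apply_proj hF α hα _ _ y.2, hxy']
  have hsurj : Function.Surjective p := by
    rintro ⟨x, hx⟩
    obtain ⟨y, rfl⟩ := S.proj_surjective zero_le hα x
    exact ⟨⟨y, hx⟩, rfl⟩
  exact ⟨hp.homeoOfEquivCompactToT2 (f := Equiv.ofBijective p ⟨hinj, hsurj⟩), fun _ => rfl⟩

/-- The pullback along `π_{0,α}` is an isometric isomorphism of `A_0 | S_0` onto `A_α | S_α`. -/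
theorem exists_isometric_restrictAlgebra_equiv {I₀ : Ideal (S.A 0)}
    (hF : ∀ (α : Ordinal.{v}) (hα : α < τ), S.F α ⊆ S.liftSet I₀ α hα.le) {α : Ordinal.{v}}
    (hα : α ≤ τ) :
    ∃ Φ : restrictAlgebra (S.A 0) (hull I₀) ≃ₐ[ℂ] restrictAlgebra (S.A α) (S.liftHull I₀ α),
      (∀ f : S.A 0, Φ (restrictElem (hull I₀) f) =
        restrictElem (S.liftHull I₀ α) (S.pullback zero_le hα f)) ∧ Isometry Φ := by
  obtain ⟨e, he⟩ := S.exists_homeomorph_liftHull hF hα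
  let ψ : C(hull I₀, ℂ) →ₐ[ℂ] C(S.liftHull I₀ α, ℂ) :=
    ContinuousMap.compRightAlgHom ℂ ℂ (e : C(S.liftHull I₀ α, hull I₀))
  have hψ : ∀ f : S.A 0, ψ (restrictHom (hull I₀) f) =
      restrictHom (S.liftHull I₀ α) (S.pullback zero_le hα f : C(S.X α, ℂ)) := fun f =>
    ContinuousMap.ext fun y => congr_arg (f : C(S.X 0, ℂ)) (he y)
  have hmem : ∀ g : restrictAlgebra (S.A 0) (hull I₀),
      ψ g ∈ restrictAlgebra (S.A α) (S.liftHull I₀ α) := by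
    rintro ⟨_, f, hf, rfl⟩
    exact ⟨_, (S.pullback zero_le hα ⟨f, hf⟩).2, (hψ ⟨f, hf⟩).symm⟩
  let Φ : restrictAlgebra (S.A 0) (hull I₀) →ₐ[ℂ] restrictAlgebra (S.A α) (S.liftHull I₀ α) :=
    (ψ.comp (Subalgebra.val _)).codRestrict _ hmem
  have hΦ : ∀ f : S.A 0, Φ (restrictElem (hull I₀) f) =
      restrictElem (S.liftHull I₀ α) (S.pullback zero_le hα f) := fun f => Subtype.ext (hψ f)
  have hnorm : ∀ g, ‖Φ g‖ = ‖g‖ := by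
    intro g
    refine le_antisymm ((ContinuousMap.norm_le _ (norm_nonneg _)).mpr fun y =>
        ContinuousMap.norm_coe_le_norm (g : C(hull I₀, ℂ)) (e y))
      ((ContinuousMap.norm_le _ (norm_nonneg _)).mpr fun x => ?_)
    obtain ⟨y, rfl⟩ := e.surjective x
    exact ContinuousMap.norm_coe_le_norm (Φ g : C(S.liftHull I₀ α, ℂ)) y
  have hiso : Isometry Φ := AddMonoidHomClass.isometry_of_norm Φ hnorm
  have hsurj : Function.Surjective Φ := by
    rintro ⟨_, g, hg, rfl⟩
    -- On `S_α`, `g` is the pullback of `T g`, so `T g` supplies the preimage.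
    refine ⟨restrictElem (hull I₀) (S.T α hα ⟨g, hg⟩), ?_⟩
    rw [hΦ]
    exact Subtype.ext (ContinuousMap.ext fun y => S.T_apply_proj hF α hα ⟨g, hg⟩ y y.2)
  exact ⟨AlgEquiv.ofBijective Φ ⟨hiso.injective, hsurj⟩, hΦ, hiso⟩

end RootSystem

end

/-! ### Assembling the theorem -/

theorem mainTheorem7 {τ : Ordinal.{v}} (_hτ : Ordinal.omega0 ≤ τ) (S : RootSystem.{u, v} τ)
    (I₀ : Ideal (S.A 0)) (_hI₀ : IsClosed (I₀ : Set (S.A 0)))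
    (_hF : ∀ (α : Ordinal.{v}) (hα : α < τ), S.F α ⊆ S.liftSet I₀ α hα.le)
    (α : Ordinal.{v}) (hα : α ≤ τ) :
    -- `π_{0,α}` takes `S_α` homeomorphically onto `S_0`
    (∃ e : S.liftHull I₀ α ≃ₜ hull I₀, ∀ y, (e y : S.X 0) = S.proj zero_le (y : S.X α)) ∧
    -- `π*_{0,α}` induces an isometric isomorphism of `A_0 | S_0` onto `A_α | S_α`
    (∃ Φ : restrictAlgebra (S.A 0) (hull I₀) ≃ₐ[ℂ] restrictAlgebra (S.A α) (S.liftHull I₀ α),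
      (∀ f : S.A 0, Φ (restrictElem (hull I₀) f) =
        restrictElem (S.liftHull I₀ α) (S.pullback zero_le hα f)) ∧ Isometry Φ) ∧
    -- `I_α` is a closed ideal with the stated properties
    ∃ J : Ideal (S.A α), (J : Set (S.A α)) = S.liftSet I₀ α hα ∧
      IsClosed (J : Set (S.A α)) ∧
      hull J = S.liftHull I₀ α ∧
      (J : Set (S.A α)) ∩ Set.range (S.pullback zero_le hα) =
        S.pullback zero_le hα '' (I₀ : Set (S.A 0)) ∧
      (∃ Ψ : (S.A α ⧸ J) ≃ₐ[ℂ] (S.A 0 ⧸ I₀), ∀ x, ‖Ψ x‖ = ‖x‖) ∧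
      Nonempty (ClosedIdealsAbove J ≃o ClosedIdealsAbove I₀) := by
  have hmul := S.T_mul_sub_mem _hI₀ _hF α hα
  have hnorm := S.norm_pullback (zero_le (a := α)) hα
  have hTP := S.T_pullback_zero hα
  have hmem := mem_ker_quotientAlgHom (S.T α hα) I₀ (S.T_one hα) hmul
  refine ⟨S.exists_homeomorph_liftHull _hF hα, S.exists_isometric_restrictAlgebra_equiv _hF hα,
    RingHom.ker (quotientAlgHom (S.T α hα) I₀ (S.T_one hα) hmul), Set.ext hmem, ?_, ?_, ?_, ?_, ?_⟩
  · rw [show ((RingHom.ker (quotientAlgHom (S.T α hα) I₀ (S.T_one hα) hmul) : Ideal (S.A α)) :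
      Set (S.A α)) = S.T α hα ⁻¹' (I₀ : Set (S.A 0)) from Set.ext hmem]
    exact _hI₀.preimage (S.T α hα).continuous
  · ext x
    -- A common zero of `I_α` lies over `S_0` because pullbacks of `I_0` belong to `I_α`;
    -- conversely, on `S_α` a function `g ∈ I_α` takes values of `T g ∈ I_0` on `S_0`.
    refine ⟨fun hx f hf => hx (S.pullback zero_le hα f) ((hmem _).mpr (by rwa [hTP])),
      fun hx g hg => ?_⟩
    rw [← S.T_apply_proj _hF α hα g x hx]
    exact hx _ ((hmem g).mp hg)
  · ext g
    constructor
    · rintro ⟨hg, f, rfl⟩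
      exact ⟨f, (hTP f) ▸ (hmem _).mp hg, rfl⟩
    · rintro ⟨f, hf, rfl⟩
      exact ⟨(hmem _).mpr (by rwa [hTP]), f, rfl⟩
  · exact exists_isometric_quotient_equiv (A := S.A 0) (B := S.A α) (S.pullback zero_le hα) (S.T α hα) I₀ hnorm
      (S.T_pullback_and_norm_le α hα).2 hTP (S.T_one hα) hmul
  · exact ⟨closedIdealsOrderIso (A := S.A 0) (B := S.A α) (S.pullback zero_le hα)
      (AddMonoidHomClass.isometry_of_norm (S.pullback zero_le hα) hnorm).continuous (S.T α hα) I₀ hTP (S.T_one hα) hmul⟩
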